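/- Let $k$ be a field with $\operatorname{char} k\neq 2$, let $V$ be a $k$-vector space with basis $\mathcal B=\{x_1,\dots,x_n\}$, let $\mu=(\mu_{ij})$ be an $n\times n$ matrix over $k$ that is multiplicatively antisymmetric, i.e. $\mu_{ij}\mu_{ji}=\mu_{ii}=1$ for all $i,j$, and let $\phi:V\times V\to k$ be a bilinear form that is $\mu$-symmetric relative to $\mathcal B$, i.e. $\phi(x_i,x_j)=\mu_{ij}\phi(x_j,x_i)$ for all $i,j$. The skew Clifford algebra $\mathrm{sCl}(V,\mu,\phi)$ is the quotient of the tensor algebra $T(V)$ by the two-sided ideal generated by the elements $x_i\otimes x_j+\mu_{ij}\,x_j\otimes x_i-2\phi(x_i,x_j)\cdot 1$ for all $i,j$, and $g:V\to \mathrm{sCl}(V,\mu,\phi)$ is the inclusion $V\to T(V)$ followed by the projection. If $\mathrm{sCl}(V,\mu,\phi)\neq 0$, then there is a subset $\mathcal B'\subseteq\mathcal B$ with the following properties. Let $V'$ be the span of $\mathcal B'$, with basis $\mathcal B'$, and let $\mu'$ be the submatrix of $\mu$ whose rows and columns correspond to $\mathcal B'$. Then $\mu'$ is multiplicatively antisymmetric,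 $\phi|_{V'}$ is $\mu'$-symmetric relative to $\mathcal B'$, the $k$-algebras $\mathrm{sCl}(V,\mu,\phi)$ and $\mathrm{sCl}(V',\mu',\phi|_{V'})$ are isomorphic, the restriction $g|_{V'}:V'\to\mathrm{sCl}(V,\mu,\phi)$ is injective, and $\mathrm{sCl}(V',\mu',\phi|_{V'})$ has full dimension, i.e. $\dim_k \mathrm{sCl}(V',\mu',\phi|_{V'})=2^{\dim V'}$. -/

import Mathlib

/-- A square matrix `μ` is multiplicatively antisymmetric if `μ i j * μ j i = μ i i = 1`
for all `i, j`. -/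
def IsMulAntisymm {k ι : Type*} [Field k] (μ : Matrix ι ι k) : Prop :=
  ∀ i j, μ i j * μ j i = 1 ∧ μ i i = 1

/-- A bilinear form `φ` on `V` is `μ`-symmetric relative to the basis `x` of `V` if
`φ (x i) (x j) = μ i j * φ (x j) (x i)` for all `i, j`. -/
def IsMuSymm {k V ι : Type*} [Field k] [AddCommGroup V] [Module k V]
    (x : Module.Basis ι k V) (μ : Matrix ι ι k) (φ : LinearMap.BilinForm k V) : Prop :=
  ∀ i j, φ (x i) (x j) = μ i j * φ (x j) (x i)

namespace SkewCliffordAlgebra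

/-- The defining relations `x i ⊗ x j + μ i j • x j ⊗ x i = 2 φ(x i, x j) · 1` in the
tensor algebra of `V`. -/
inductive Rel {k V ι : Type*} [Field k] [AddCommGroup V] [Module k V]
    (x : Module.Basis ι k V) (μ : Matrix ι ι k) (φ : LinearMap.BilinForm k V) :
    TensorAlgebra k V → TensorAlgebra k V → Prop
  | of (i j : ι) : Rel x μ φ
      (TensorAlgebra.ι k (x i) * TensorAlgebra.ι k (x j) +
        μ i j • (TensorAlgebra.ι k (x j) * TensorAlgebra.ι k (x i)))
      (algebraMap k (TensorAlgebra k V) (2 * φ (x i) (x j)))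

end SkewCliffordAlgebra

/-- The skew Clifford algebra `sCl(V, μ, φ)` relative to the basis `x` of `V`: the quotient of the
tensor algebra of `V` by the two-sided ideal generated by the elements
`x i ⊗ x j + μ i j • x j ⊗ x i - 2 φ(x i, x j) · 1`. -/
def SkewCliffordAlgebra {k V ι : Type*} [Field k] [AddCommGroup V] [Module k V]
    (x : Module.Basis ι k V) (μ : Matrix ι ι k) (φ : LinearMap.BilinForm k V) : Type _ :=
  RingQuot (SkewCliffordAlgebra.Rel x μ φ)

namespace SkewCliffordAlgebra

instance instRing {k V ι : Type*} [Field k] [AddCommGroup V] [Module k V]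
    (x : Module.Basis ι k V) (μ : Matrix ι ι k) (φ : LinearMap.BilinForm k V) :
    Ring (SkewCliffordAlgebra x μ φ) :=
  inferInstanceAs (Ring (RingQuot _))

instance instAlgebra {k V ι : Type*} [Field k] [AddCommGroup V] [Module k V]
    (x : Module.Basis ι k V) (μ : Matrix ι ι k) (φ : LinearMap.BilinForm k V) :
    Algebra k (SkewCliffordAlgebra x μ φ) :=
  inferInstanceAs (Algebra k (RingQuot _))

/-- The projection of the tensor algebra onto `sCl(V, μ, φ)`. -/
def proj {k V ι : Type*} [Field k] [AddCommGroup V] [Module k V]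
    (x : Module.Basis ι k V) (μ : Matrix ι ι k) (φ : LinearMap.BilinForm k V) :
    TensorAlgebra k V →ₐ[k] SkewCliffordAlgebra x μ φ :=
  RingQuot.mkAlgHom k (Rel x μ φ)

/-- The canonical linear map `g : V → sCl(V, μ, φ)`: the inclusion of `V` into its tensor algebra
followed by the projection onto the quotient. -/
noncomputable def g {k V ι : Type*} [Field k] [AddCommGroup V] [Module k V]
    (x : Module.Basis ι k V) (μ : Matrix ι ι k) (φ : LinearMap.BilinForm k V) :
    V →ₗ[k] SkewCliffordAlgebra x μ φ :=
  (proj x μ φ).toLinearMap ∘ₗ TensorAlgebra.ι k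

/-- `sCl(V, μ, φ)` has full dimension if its dimension is `2 ^ dim V`. (For a finite-dimensional
`V` this includes finite-dimensionality of the algebra, since `2 ^ dim V ≠ 0`.) -/
def HasFullDimension {k V ι : Type*} [Field k] [AddCommGroup V] [Module k V]
    (x : Module.Basis ι k V) (μ : Matrix ι ι k) (φ : LinearMap.BilinForm k V) : Prop :=
  Module.finrank k (SkewCliffordAlgebra x μ φ) = 2 ^ Module.finrank k V

/-- The subspace `V'` of `V` spanned by the basis vectors `x i` with `i ∈ s`. -/
abbrev subspace {k V ι : Type*} [Field k] [AddCommGroup V] [Module k V]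
    (x : Module.Basis ι k V) (s : Set ι) : Submodule k V :=
  Submodule.span k (Set.range fun i : s => x i)

/-- The vectors `x i` with `i ∈ s`, as a basis of their span. -/
noncomputable def subbasis {k V ι : Type*} [Field k] [AddCommGroup V] [Module k V]
    (x : Module.Basis ι k V) (s : Set ι) : Module.Basis s k (subspace x s) :=
  Module.Basis.span (x.linearIndependent.comp (fun i : s => (i : ι)) Subtype.val_injective)

/-- The submatrix of `μ` with rows and columns in `s`. -/
def submatrix {k ι : Type*} (μ : Matrix ι ι k) (s : Set ι) : Matrix s s k :=
  μ.submatrix Subtype.val Subtype.val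

end SkewCliffordAlgebra

/-! Write `q i j` for `φ (x i) (x j)` and `a i` for the image of `x i`. Since `a j * a l + μ j l • a
l * a j` is the scalar `2 * q j l`, and `a i` skew-commutes past the left side with factor `μ i j *
μ i l` up to lower terms, full dimension is governed by condition (C): `q j l ≠ 0` implies `μ i j *
μ i l = 1` for every `i`.

(C) suffices. Ordered monomials span by reordering. For independence, the algebra acts on the skew
exterior algebra by creation operators plus combinations of annihilation operators; (C) is what
makes these operators satisfy the relations (`fock_mul_fock`). Applied to the vacuum, the ordered
monomials give the standard basis (`fock_single`).

(C) can be reached. Take a minimal set `s` of indices whose generators, with the relations among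
them, still present the algebra. A generator that vanishes, or that is a multiple of another
generator `a j` with some `q j p ≠ 0`, could be discarded (`IsPresentedBy.diff_singleton`,
`IsPresentedBy.remove_multiples`), so neither occurs in `s`. Associativity of `a i * a j * a l`
gives a linear relation among three generators (`overlap`); with these exclusions it forces (C) on
`s`. -/

namespace SkewCliffordAlgebra

/-! ### Fock representation on the skew exterior algebra -/

section Fock

variable {k ι : Type*} [Field k] [LinearOrder ι]

/-- The factor picked up when `e i` moves past `e j` towards its place in an ordered monomial. -/
def swapFactor (μ : Matrix ι ι k) (i j : ι) : k := if j < i then -μ i j else 1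

/-- The factor picked up when `e i` moves to its place in the ordered monomial `e T`. -/
def insertFactor (μ : Matrix ι ι k) (i : ι) (T : Finset ι) : k := ∏ l ∈ T, swapFactor μ i l

/-- Left multiplication by `e i` on the skew exterior algebra, whose elements are given by their
coordinates relative to the ordered monomials. -/
def creation (μ : Matrix ι ι k) (i : ι) : Module.End k (Finset ι → k) where
  toFun f T := if i ∈ T then insertFactor μ i T * f (T.erase i) else 0
  map_add' f g := by ext T; by_cases h : i ∈ T <;> simp [h, mul_add]
  map_smul' c f := by ext T; by_cases h : i ∈ T <;> simp [h, mul_left_comm]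

/-- The skew derivation dual to `e i` on the skew exterior algebra. -/
def annihilation (μ : Matrix ι ι k) (i : ι) : Module.End k (Finset ι → k) where
  toFun f T := if i ∈ T then 0 else (insertFactor μ i T)⁻¹ * f (insert i T)
  map_add' f g := by ext T; by_cases h : i ∈ T <;> simp [h, mul_add]
  map_smul' c f := by ext T; by_cases h : i ∈ T <;> simp [h, mul_left_comm]

theorem creation_apply (μ : Matrix ι ι k) (i : ι) (f : Finset ι → k) (T : Finset ι) :
    creation μ i f T = if i ∈ T then insertFactor μ i T * f (T.erase i) else 0 := rfl

theorem annihilation_apply (μ : Matrix ι ι k) (i : ι) (f : Finset ι → k) (T : Finset ι) :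
    annihilation μ i f T = if i ∈ T then 0 else (insertFactor μ i T)⁻¹ * f (insert i T) := rfl

theorem insertFactor_insert (μ : Matrix ι ι k) (i : ι) {j : ι} {T : Finset ι} (h : j ∉ T) :
    insertFactor μ i (insert j T) = swapFactor μ i j * insertFactor μ i T :=
  Finset.prod_insert h

theorem swapFactor_self (μ : Matrix ι ι k) (i : ι) : swapFactor μ i i = 1 := by
  simp [swapFactor]

theorem swapFactor_ne_zero {μ : Matrix ι ι k} (hμ : IsMulAntisymm μ) (i j : ι) :
    swapFactor μ i j ≠ 0 := by
  unfold swapFactor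
  split_ifs
  · exact neg_ne_zero.2 (left_ne_zero_of_mul_eq_one (hμ i j).1)
  · exact one_ne_zero

theorem insertFactor_ne_zero {μ : Matrix ι ι k} (hμ : IsMulAntisymm μ) (i : ι) (T : Finset ι) :
    insertFactor μ i T ≠ 0 :=
  Finset.prod_ne_zero_iff.2 fun j _ => swapFactor_ne_zero hμ i j

theorem swapFactor_eq {μ : Matrix ι ι k} (hμ : IsMulAntisymm μ) {i j : ι} (h : i ≠ j) :
    swapFactor μ i j = -(μ i j * swapFactor μ j i) := by
  unfold swapFactor
  rcases lt_or_gt_of_ne h with h | h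
  · simp [h, h.not_gt, (hμ i j).1]
  · simp [h, h.not_gt]

theorem creation_mul_creation {μ : Matrix ι ι k} (hμ : IsMulAntisymm μ) (i j : ι) :
    creation μ i * creation μ j + μ i j • (creation μ j * creation μ i) = 0 := by
  ext f T
  rcases eq_or_ne i j with rfl | hij
  · simp [creation_apply]
  by_cases hi : i ∈ T
  swap
  · simp [creation_apply, hi]
  by_cases hj : j ∈ T
  swap
  · simp [creation_apply, hj]
  obtain ⟨T, hiT, rfl⟩ : ∃ U, i ∉ U ∧ insert i U = T :=
    ⟨T.erase i, Finset.notMem_erase i T, Finset.insert_erase hi⟩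
  have hj' : j ∈ T := (Finset.mem_insert.1 hj).resolve_left hij.symm
  obtain ⟨U, hjU, rfl⟩ : ∃ U, j ∉ U ∧ insert j U = T :=
    ⟨T.erase j, Finset.notMem_erase j T, Finset.insert_erase hj'⟩
  have hiU : i ∉ U := fun h => hiT (Finset.mem_insert_of_mem h)
  have e1 : (insert i (insert j U)).erase j = insert i U := by
    rw [Finset.insert_comm, Finset.erase_insert]; simp [hij.symm, hjU]
  have e2 : (insert i (insert j U)).erase i = insert j U := Finset.erase_insert hiT
  simp only [LinearMap.add_apply, LinearMap.smul_apply, Module.End.mul_apply, Pi.add_apply,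
    Pi.smul_apply, creation_apply, hi, hj, if_true, e1, e2, Finset.mem_insert_self,
    Finset.erase_insert hiU, Finset.erase_insert hjU, smul_eq_mul, LinearMap.zero_apply,
    Pi.zero_apply]
  have hjiU : j ∉ insert i U := by simp [hij.symm, hjU]
  rw [insertFactor_insert μ i hiT, insertFactor_insert μ i hjU, insertFactor_insert μ j hjU,
    Finset.insert_comm, insertFactor_insert μ j hjiU, insertFactor_insert μ j hiU,
    insertFactor_insert μ i hiU, swapFactor_self, swapFactor_self, swapFactor_eq hμ hij]
  ring

theorem annihilation_mul_annihilation {μ : Matrix ι ι k} (hμ : IsMulAntisymm μ) (i j : ι) :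
    annihilation μ i * annihilation μ j + μ i j • (annihilation μ j * annihilation μ i) = 0 := by
  ext f T
  rcases eq_or_ne i j with rfl | hij
  · simp [annihilation_apply]
  by_cases hi : i ∈ T
  · simp [annihilation_apply, hi]
  by_cases hj : j ∈ T
  · simp [annihilation_apply, hj]
  have hij' : i ∉ insert j T := by simp [hij, hi]
  have hji' : j ∉ insert i T := by simp [hij.symm, hj]
  simp only [LinearMap.add_apply, LinearMap.smul_apply, Module.End.mul_apply, Pi.add_apply,
    Pi.smul_apply, annihilation_apply, hi, hj, if_false, hij', hji', smul_eq_mul,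
    LinearMap.zero_apply, Pi.zero_apply]
  rw [insertFactor_insert μ i hj, insertFactor_insert μ j hi, swapFactor_eq hμ hij,
    Finset.insert_comm]
  have h1 := swapFactor_ne_zero hμ j i
  have h2 := insertFactor_ne_zero hμ i T
  have h3 := insertFactor_ne_zero hμ j T
  have h4 : μ i j ≠ 0 := left_ne_zero_of_mul_eq_one (hμ i j).1
  field_simp
  ring

/-- The factor is `μ j i`, not `μ i j`: annihilation operators carry the weight inverse to that of
the corresponding generators. -/
theorem annihilation_mul_creation {μ : Matrix ι ι k} (hμ : IsMulAntisymm μ) (i j : ι) :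
    annihilation μ i * creation μ j + μ j i • (creation μ j * annihilation μ i) =
      if i = j then 1 else 0 := by
  ext f T
  rcases eq_or_ne i j with rfl | hij
  · by_cases hi : i ∈ T
    · simp [annihilation_apply, creation_apply, hi, (hμ i i).2]
      have : insertFactor μ i T = insertFactor μ i (T.erase i) := by
        conv_lhs => rw [← Finset.insert_erase hi,
          insertFactor_insert μ i (Finset.notMem_erase i T), swapFactor_self, one_mul]
      rw [this, mul_inv_cancel_left₀ (insertFactor_ne_zero hμ _ _)]
    · simp [annihilation_apply, creation_apply, hi]
      rw [insertFactor_insert μ i hi, swapFactor_self, one_mul,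
        inv_mul_cancel_left₀ (insertFactor_ne_zero hμ _ _)]
  by_cases hi : i ∈ T
  · simp [annihilation_apply, creation_apply, hi, hij]
  by_cases hj : j ∈ T
  swap
  · simp [annihilation_apply, creation_apply, hj, hij, hij.symm]
  obtain ⟨U, hjU, rfl⟩ : ∃ U, j ∉ U ∧ insert j U = T :=
    ⟨T.erase j, Finset.notMem_erase j T, Finset.insert_erase hj⟩
  have hiU : i ∉ U := fun h => hi (Finset.mem_insert_of_mem h)
  have hjU' : j ∉ insert i U := by simp [hij.symm, hjU]
  have e1 : (insert i (insert j U)).erase j = insert i U := by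
    rw [Finset.insert_comm, Finset.erase_insert hjU']
  have hj2 : j ∈ insert i (insert j U) := by simp
  simp only [LinearMap.add_apply, LinearMap.smul_apply, Module.End.mul_apply, Pi.add_apply,
    Pi.smul_apply, annihilation_apply, creation_apply, hi, hj, hij, hj2, if_false, if_true, hiU,
    smul_eq_mul, LinearMap.zero_apply, Pi.zero_apply, e1, Finset.erase_insert hjU]
  rw [Finset.insert_comm, insertFactor_insert μ j hjU', insertFactor_insert μ j hiU,
    insertFactor_insert μ i hjU, insertFactor_insert μ j hjU, swapFactor_self,
    swapFactor_eq hμ hij.symm]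
  have h1 := swapFactor_ne_zero hμ i j
  have h2 := insertFactor_ne_zero hμ i U
  field_simp
  ring

/-- The coefficients `q` made lower triangular, in a way that keeps `2 * q i j` as the value of the
skew commutators. -/
def triangular (q : ι → ι → k) (i j : ι) : k :=
  if i = j then q i i else if j < i then 2 * q i j else 0

theorem triangular_ne_zero {q : ι → ι → k} {i j : ι} (h : triangular q i j ≠ 0) : q i j ≠ 0 := by
  unfold triangular at h
  split_ifs at h with h1 h2
  · exact h1 ▸ h
  · exact right_ne_zero_of_mul h
  · exact absurd rfl h

theorem triangular_add {μ : Matrix ι ι k} (hμ : IsMulAntisymm μ) {q : ι → ι → k}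
    (hq : ∀ i j, q i j = μ i j * q j i) (i j : ι) :
    triangular q i j + μ i j * triangular q j i = 2 * q i j := by
  unfold triangular
  rcases lt_trichotomy i j with h | rfl | h
  · simp [h.ne, h.ne', h, h.not_gt, hq i j]; ring
  · simp [(hμ i i).2]; ring
  · simp [h.ne, h.ne', h, h.not_gt]

variable [Fintype ι]

/-- The action of the `i`-th generator of the skew Clifford algebra on the skew exterior algebra. -/
noncomputable def fock (μ : Matrix ι ι k) (q : ι → ι → k) (i : ι) : Module.End k (Finset ι → k) :=
  creation μ i + ∑ a, triangular q i a • annihilation μ a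

/-- By `hC`, whenever `q i a ≠ 0` the annihilation operator of `a` has the same commutation factors
as the creation operator of `i`. All summands of `fock μ q i` therefore skew-commute by the same
rule, and only the mixed terms leave scalars, adding up to `2 * q i j` by `triangular_add`. -/
theorem fock_mul_fock {μ : Matrix ι ι k} (hμ : IsMulAntisymm μ) {q : ι → ι → k}
    (hq : ∀ i j, q i j = μ i j * q j i)
    (hC : ∀ i j l, q j l ≠ 0 → μ i j * μ i l = 1) (i j : ι) :
    fock μ q i * fock μ q j + μ i j • (fock μ q j * fock μ q i) =
      algebraMap k _ (2 * q i j) := by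
  have hC' : ∀ i a l, q i a ≠ 0 → μ i l = μ l a := fun i a l h => by
    have h1 := hC l i a h
    have h2 := (hμ i l).1
    calc μ i l = μ i l * (μ l i * μ l a) := by rw [h1, mul_one]
      _ = (μ i l * μ l i) * μ l a := by ring
      _ = μ l a := by rw [h2, one_mul]
  have hDE : ∀ i j, (∑ a, triangular q i a • annihilation μ a) * creation μ j +
      μ i j • (creation μ j * ∑ a, triangular q i a • annihilation μ a) =
        algebraMap k _ (triangular q i j) := fun i j => by
    have : ∀ a, triangular q i a • annihilation μ a * creation μ j +
        μ i j • (creation μ j * triangular q i a • annihilation μ a) =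
        if a = j then algebraMap k _ (triangular q i j) else 0 := fun a => by
      by_cases h : triangular q i a = 0
      · rcases eq_or_ne a j with rfl | haj
        · simp [h]
        · simp [h, haj]
      · rw [hC' i a j (triangular_ne_zero h), smul_mul_assoc, mul_smul_comm, smul_comm (μ j a),
          ← smul_add, annihilation_mul_creation hμ]
        split_ifs with haj
        · rw [haj, Algebra.algebraMap_eq_smul_one]
        · simp
    rw [Finset.sum_mul, Finset.mul_sum, Finset.smul_sum, ← Finset.sum_add_distrib,
      Finset.sum_congr rfl fun a _ => this a]
    simp
  have hDD : (∑ a, triangular q i a • annihilation μ a) *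
      (∑ b, triangular q j b • annihilation μ b) +
      μ i j • ((∑ b, triangular q j b • annihilation μ b) *
        ∑ a, triangular q i a • annihilation μ a) = 0 := by
    rw [Finset.sum_mul_sum, Finset.sum_mul_sum, Finset.sum_comm (s := Finset.univ) (t := Finset.univ)
      (f := fun b a => triangular q j b • annihilation μ b * triangular q i a • annihilation μ a),
      Finset.smul_sum, ← Finset.sum_add_distrib]
    refine Finset.sum_eq_zero fun a _ => ?_
    rw [Finset.smul_sum, ← Finset.sum_add_distrib]
    refine Finset.sum_eq_zero fun b _ => ?_
    by_cases ha : triangular q i a = 0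
    · simp [ha]
    by_cases hb : triangular q j b = 0
    · simp [hb]
    -- The chain is `μ i j = μ j a = μ a b`, one use of `hC'` for each nonzero coefficient.
    rw [hC' i a j (triangular_ne_zero ha), hC' j b a (triangular_ne_zero hb)]
    have := annihilation_mul_annihilation hμ a b
    rw [smul_mul_smul_comm, smul_mul_smul_comm, mul_comm (triangular q j b), smul_comm (μ a b),
      ← smul_add, this, smul_zero]
  have hEE := creation_mul_creation hμ i j
  have h1 := hDE i j
  have h2 : creation μ i * (∑ a, triangular q j a • annihilation μ a) +
      μ i j • ((∑ a, triangular q j a • annihilation μ a) * creation μ i) =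
        algebraMap k _ (μ i j * triangular q j i) := by
    rw [map_mul, ← hDE j i, mul_add, ← Algebra.smul_def, ← Algebra.smul_def, smul_smul, (hμ i j).1,
      one_smul, add_comm]
  rw [← triangular_add hμ hq, map_add, ← h1, ← h2]
  unfold fock
  generalize (∑ a, triangular q i a • annihilation μ a) = D at *
  generalize (∑ a, triangular q j a • annihilation μ a) = D' at *
  have expand : (creation μ i + D) * (creation μ j + D') +
      μ i j • ((creation μ j + D') * (creation μ i + D)) =
      (creation μ i * creation μ j + μ i j • (creation μ j * creation μ i)) +
      (D * D' + μ i j • (D' * D)) +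
      (D * creation μ j + μ i j • (creation μ j * D) +
        (creation μ i * D' + μ i j • (D' * creation μ i))) := by
    simp only [add_mul, mul_add, smul_add]
    abel
  rw [expand, hEE, hDD, zero_add, zero_add]

/-- This is the purpose of the triangular coefficients: `fock μ q m` annihilates only indices `a ≤
m`, none of which lie in `T`, so no lower-order correction appears. -/
theorem fock_single (μ : Matrix ι ι k) (q : ι → ι → k) {m : ι} {T : Finset ι}
    (hm : ∀ l ∈ T, m < l) :
    fock μ q m (Pi.single T 1) = Pi.single (insert m T) 1 := by
  have hmT : m ∉ T := fun h => lt_irrefl _ (hm m h)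
  have h1 : creation μ m (Pi.single T 1) = Pi.single (insert m T) 1 := by
    ext U
    rw [creation_apply]
    split_ifs with hU
    · obtain ⟨U, hmU, rfl⟩ : ∃ W, m ∉ W ∧ insert m W = U :=
        ⟨U.erase m, Finset.notMem_erase m U, Finset.insert_erase hU⟩
      rw [Finset.erase_insert hmU]
      by_cases hUT : U = T
      · subst hUT
        rw [Pi.single_eq_same, Pi.single_eq_same, mul_one, insertFactor_insert μ m hmU,
          swapFactor_self, one_mul]
        exact Finset.prod_eq_one fun l hl => if_neg (hm l hl).not_gt
      · rw [Pi.single_eq_of_ne hUT, Pi.single_eq_of_ne, mul_zero]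
        intro h
        apply hUT
        rw [← Finset.erase_insert hmU, h, Finset.erase_insert hmT]
    · rw [Pi.single_eq_of_ne]
      rintro rfl
      exact hU (Finset.mem_insert_self m T)
  have h2 : ∀ a, triangular q m a • annihilation μ a (Pi.single T 1) = 0 := fun a => by
    by_cases ha : a ∈ T
    · have : triangular q m a = 0 := by
        simp [triangular, (hm a ha).ne, (hm a ha).not_gt]
      rw [this, zero_smul]
    · have : annihilation μ a (Pi.single T 1) = 0 := by
        ext U
        rw [annihilation_apply]
        split_ifs with hU
        · rfl
        · rw [Pi.single_eq_of_ne, mul_zero]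
          · rfl
          · rintro rfl
            exact ha (Finset.mem_insert_self a U)
      rw [this, smul_zero]
  simp only [fock, LinearMap.add_apply, LinearMap.sum_apply, LinearMap.smul_apply, h1, h2,
    Finset.sum_const_zero, add_zero]

end Fock

/-! ### Generators and universal property -/

section UniversalProperty

variable {k V ι : Type*} [Field k] [AddCommGroup V] [Module k V]
  (x : Module.Basis ι k V) (μ : Matrix ι ι k) (φ : LinearMap.BilinForm k V)

theorem g_mul_g (i j : ι) :
    g x μ φ (x i) * g x μ φ (x j) + μ i j • (g x μ φ (x j) * g x μ φ (x i)) =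
      algebraMap k _ (2 * φ (x i) (x j)) := by
  have h : proj x μ φ (TensorAlgebra.ι k (x i) * TensorAlgebra.ι k (x j) +
      μ i j • (TensorAlgebra.ι k (x j) * TensorAlgebra.ι k (x i))) =
      proj x μ φ (algebraMap k (TensorAlgebra k V) (2 * φ (x i) (x j))) :=
    RingQuot.mkAlgHom_rel k (Rel.of i j)
  rw [map_add, map_smul, map_mul, map_mul, AlgHom.commutes] at h
  exact h

theorem adjoin_range_g : Algebra.adjoin k (Set.range fun i => g x μ φ (x i)) = ⊤ := by
  have h1 : (⊤ : Subalgebra k (TensorAlgebra k V)) =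
      Algebra.adjoin k (Set.range fun i => TensorAlgebra.ι k (x i)) := by
    refine le_antisymm ?_ le_top
    rw [← TensorAlgebra.adjoin_range_ι, Algebra.adjoin_le_iff]
    rintro _ ⟨v, rfl⟩
    have : v ∈ (Subalgebra.toSubmodule
        (Algebra.adjoin k (Set.range fun i => TensorAlgebra.ι k (x i)))).comap
        (TensorAlgebra.ι k) := by
      have hv : v ∈ Submodule.span k (Set.range x) := by simp [x.span_eq]
      refine Submodule.span_le.2 ?_ hv
      rintro _ ⟨i, rfl⟩
      exact Algebra.subset_adjoin ⟨i, rfl⟩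
    exact this
  have h2 : (proj x μ φ).range = ⊤ :=
    (AlgHom.range_eq_top _).2 (RingQuot.mkAlgHom_surjective k (Rel x μ φ))
  rw [← h2, ← Algebra.map_top, h1, AlgHom.map_adjoin, ← Set.range_comp]
  rfl

theorem exists_lift {B : Type*} [Ring B] [Algebra k B] (y : ι → B)
    (hy : ∀ i j, y i * y j + μ i j • (y j * y i) = algebraMap k B (2 * φ (x i) (x j))) :
    ∃ f : SkewCliffordAlgebra x μ φ →ₐ[k] B, ∀ i, f (g x μ φ (x i)) = y i := by
  have w : ∀ ⦃a b⦄, Rel x μ φ a b → TensorAlgebra.lift k (x.constr k y) a =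
      TensorAlgebra.lift k (x.constr k y) b := by
    rintro _ _ ⟨i, j⟩
    simp only [map_add, map_smul, map_mul, TensorAlgebra.lift_ι_apply, AlgHom.commutes,
      Module.Basis.constr_basis]
    simpa using hy i j
  refine ⟨RingQuot.liftAlgHom k ⟨TensorAlgebra.lift k (x.constr k y), w⟩, fun i => ?_⟩
  have := RingQuot.liftAlgHom_mkAlgHom_apply k (TensorAlgebra.lift k (x.constr k y)) w
    (TensorAlgebra.ι k (x i))
  rw [TensorAlgebra.lift_ι_apply, Module.Basis.constr_basis] at this
  exact this

end UniversalProperty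

/-! ### Ordered monomials span -/

section Monomials

variable {k ι A : Type*} [Field k] [LinearOrder ι] [Ring A] [Algebra k A]

/-- The product of the `a i` with `i ∈ T`, in increasing order. -/
def monomial (a : ι → A) (T : Finset ι) : A := ((T.sort (· ≤ ·)).map a).prod

theorem monomial_empty (a : ι → A) : monomial a ∅ = 1 := by simp [monomial]

theorem monomial_insert (a : ι → A) {m : ι} {T : Finset ι} (h : ∀ l ∈ T, m < l) :
    monomial a (insert m T) = a m * monomial a T := by
  rw [monomial, Finset.sort_insert _ (fun b hb => (h b hb).le) fun hm => lt_irrefl _ (h m hm)]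
  simp [monomial]

/-- The bound `T ⊆ insert i S` is what lets the induction close: once `a i` has moved past a smaller
`a m`, every monomial that arises has all its indices above `m`, so multiplying by `a m` keeps it
ordered. -/
theorem mul_monomial_mem_span {μ : Matrix ι ι k} {q : ι → ι → k} {a : ι → A}
    (h2 : (2 : k) ≠ 0) (hμ : IsMulAntisymm μ)
    (ha : ∀ i j, a i * a j + μ i j • (a j * a i) = algebraMap k A (2 * q i j))
    (i : ι) (S : Finset ι) :
    a i * monomial a S ∈ Submodule.span k (monomial a '' {T | T ⊆ insert i S}) := by
  induction S using Finset.induction_on_min generalizing i with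
  | empty =>
    refine Submodule.subset_span ⟨{i}, by simp, ?_⟩
    simpa using monomial_insert a (m := i) (T := ∅) (by simp)
  | insert m S hm ih =>
    rcases lt_trichotomy i m with h | rfl | h
    · refine Submodule.subset_span ⟨insert i (insert m S), by simp, monomial_insert a ?_⟩
      intro l hl
      rcases Finset.mem_insert.1 hl with rfl | hl
      · exact h
      · exact h.trans (hm l hl)
    · rw [monomial_insert a hm, ← mul_assoc]
      have : a i * a i = algebraMap k A (q i i) := by
        have := ha i i
        rw [(hμ i i).2, one_smul, ← two_smul k, map_mul, ← Algebra.smul_def] at this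
        exact smul_right_injective A h2 this
      rw [this, ← Algebra.smul_def]
      refine Submodule.smul_mem _ _ (Submodule.subset_span ⟨S, ?_, rfl⟩)
      exact fun l hl => by simp [hl]
    · rw [monomial_insert a hm, ← mul_assoc, eq_sub_of_add_eq (ha i m), sub_mul, ← Algebra.smul_def,
        smul_mul_assoc, mul_assoc]
      refine Submodule.sub_mem _ (Submodule.smul_mem _ _ (Submodule.subset_span ⟨S, ?_, rfl⟩))
        (Submodule.smul_mem _ _ ?_)
      · exact fun l hl => by simp [hl]
      · have key : Submodule.span k (monomial a '' {T | T ⊆ insert i S}) ≤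
            (Submodule.span k (monomial a '' {T | T ⊆ insert i (insert m S)})).comap
              (LinearMap.mulLeft k (a m)) := by
          rw [Submodule.span_le]
          rintro _ ⟨T, hT, rfl⟩
          refine Submodule.subset_span ⟨insert m T, ?_, monomial_insert a ?_⟩
          · intro l hl
            rcases Finset.mem_insert.1 hl with rfl | hl
            · simp
            · have := hT hl
              simp only [Finset.mem_insert] at this ⊢
              tauto
          · intro l hl
            rcases Finset.mem_insert.1 (hT hl) with rfl | hl
            · exact h
            · exact hm l hl
        exact key (ih i)

theorem span_range_monomial {μ : Matrix ι ι k} {q : ι → ι → k} {a : ι → A}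
    (h2 : (2 : k) ≠ 0) (hμ : IsMulAntisymm μ)
    (ha : ∀ i j, a i * a j + μ i j • (a j * a i) = algebraMap k A (2 * q i j))
    (hgen : Algebra.adjoin k (Set.range a) = ⊤) :
    Submodule.span k (Set.range (monomial a)) = ⊤ := by
  set U := Submodule.span k (Set.range (monomial a)) with hU
  have hmul : ∀ b : A, ∀ u ∈ U, b * u ∈ U := by
    intro b
    have hb : b ∈ Algebra.adjoin k (Set.range a) := hgen ▸ Algebra.mem_top
    induction hb using Algebra.adjoin_induction with
    | mem b hb =>
      obtain ⟨i, rfl⟩ := hb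
      have : U ≤ U.comap (LinearMap.mulLeft k (a i)) := by
        conv_lhs => rw [hU]
        rw [Submodule.span_le]
        rintro _ ⟨T, rfl⟩
        exact Submodule.span_mono (Set.image_subset_range _ _) (mul_monomial_mem_span h2 hμ ha i T)
      exact fun u hu => this hu
    | algebraMap r =>
      intro u hu
      rw [← Algebra.smul_def]
      exact U.smul_mem r hu
    | add b c _ _ hb hc => exact fun u hu => add_mul b c u ▸ U.add_mem (hb u hu) (hc u hu)
    | mul b c _ _ hb hc => exact fun u hu => mul_assoc b c u ▸ hb _ (hc u hu)
  refine eq_top_iff.2 fun b _ => ?_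
  rw [← mul_one b]
  exact hmul b 1 (Submodule.subset_span ⟨∅, monomial_empty a⟩)

end Monomials

/-! ### Full dimension and injectivity under condition (C) -/

section FullDimension

variable {k V ι : Type*} [Field k] [AddCommGroup V] [Module k V] [LinearOrder ι] [Fintype ι]
  {x : Module.Basis ι k V} {μ : Matrix ι ι k} {φ : LinearMap.BilinForm k V}

theorem linearIndependent_monomial (hμ : IsMulAntisymm μ) (hφ : IsMuSymm x μ φ)
    (hC : ∀ i j l, φ (x j) (x l) ≠ 0 → μ i j * μ i l = 1) :
    LinearIndependent k (monomial fun i => g x μ φ (x i)) := by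
  obtain ⟨f, hf⟩ := exists_lift x μ φ (fock μ fun i j => φ (x i) (x j)) (fock_mul_fock hμ hφ hC)
  -- Evaluation of the Fock representation at the vacuum vector.
  let F : SkewCliffordAlgebra x μ φ →ₗ[k] (Finset ι → k) :=
    LinearMap.applyₗ (Pi.single ∅ 1) ∘ₗ f.toLinearMap
  have hF : ∀ T, F (monomial (fun i => g x μ φ (x i)) T) = Pi.single T 1 := by
    intro T
    induction T using Finset.induction_on_min with
    | empty => simp [F, monomial_empty]
    | insert m T hm ih =>
      rw [monomial_insert _ hm, ← fock_single μ (fun i j => φ (x i) (x j)) hm, ← ih]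
      simp [F, hf]
  refine LinearIndependent.of_comp F ?_
  rw [show F ∘ (monomial fun i => g x μ φ (x i)) = fun T => Pi.single T 1 from funext hF]
  convert (Pi.basisFun k (Finset ι)).linearIndependent using 1
  ext T : 1
  rw [Pi.basisFun_apply]

theorem hasFullDimension (h2 : (2 : k) ≠ 0) (hμ : IsMulAntisymm μ) (hφ : IsMuSymm x μ φ)
    (hC : ∀ i j l, φ (x j) (x l) ≠ 0 → μ i j * μ i l = 1) : HasFullDimension x μ φ := by
  have b := Module.Basis.mk (linearIndependent_monomial hμ hφ hC)
    (span_range_monomial h2 hμ (g_mul_g x μ φ) (adjoin_range_g x μ φ)).ge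
  rw [HasFullDimension, Module.finrank_eq_card_basis b, Module.finrank_eq_card_basis x,
    Fintype.card_finset]

theorem g_injective (hμ : IsMulAntisymm μ) (hφ : IsMuSymm x μ φ)
    (hC : ∀ i j l, φ (x j) (x l) ≠ 0 → μ i j * μ i l = 1) : Function.Injective (g x μ φ) := by
  -- The images of the basis vectors are the monomials of degree one.
  have h := (linearIndependent_monomial hμ hφ hC).comp (fun i : ι => ({i} : Finset ι))
    Finset.singleton_injective
  have h' : (monomial fun i => g x μ φ (x i)) ∘ (fun i : ι => ({i} : Finset ι)) =
      g x μ φ ∘ x := by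
    funext i
    simpa [monomial_empty] using
      monomial_insert (fun i => g x μ φ (x i)) (m := i) (T := ∅) (by simp)
  rw [h'] at h
  refine (injective_iff_map_eq_zero _).2 fun v hv => ?_
  rw [← x.sum_repr v, map_sum] at hv
  simp only [map_smul] at hv
  refine x.ext_elem fun i => ?_
  rw [Fintype.linearIndependent_iff.1 h _ hv i, map_zero, Finsupp.zero_apply]

end FullDimension

/-! ### Minimal presentations -/

section Presentation

universe v

variable {k ι : Type*} [Field k] {μ : Matrix ι ι k} {q : ι → ι → k}
  {A : Type v} [Ring A] [Algebra k A] {a : ι → A}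

/-- The elements `a i` with `i ∈ S` generate `A`, and the skew Clifford relations between them are
defining relations. -/
structure IsPresentedBy (μ : Matrix ι ι k) (q : ι → ι → k) (a : ι → A) (S : Set ι) : Prop where
  adjoin_eq_top : Algebra.adjoin k (a '' S) = ⊤
  exists_lift : ∀ (B : Type v) [Ring B] [Algebra k B] (y : ι → B),
    (∀ i ∈ S, ∀ j ∈ S, y i * y j + μ i j • (y j * y i) = algebraMap k B (2 * q i j)) →
      ∃ f : A →ₐ[k] B, ∀ i ∈ S, f (a i) = y i

/-- Scalars embed in a nontrivial algebra, so `a l = 0` forces every `2 * q l i` and `2 * q i l` to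
vanish. The relations involving `l` then hold when its generator is sent to `0`. -/
theorem IsPresentedBy.diff_singleton [Nontrivial A] {S : Set ι} (hS : IsPresentedBy μ q a S)
    (ha : ∀ i j, a i * a j + μ i j • (a j * a i) = algebraMap k A (2 * q i j))
    {l : ι} (hl : a l = 0) : IsPresentedBy μ q a (S \ {l}) := by
  classical
  have hq : ∀ i, 2 * q l i = 0 ∧ 2 * q i l = 0 := fun i => by
    constructor <;> apply FaithfulSMul.algebraMap_injective k A
    · rw [← ha, hl]; simp
    · rw [← ha, hl]; simp
  constructor
  · rw [eq_top_iff, ← hS.adjoin_eq_top, Algebra.adjoin_le_iff]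
    rintro _ ⟨i, hi, rfl⟩
    by_cases hil : i = l
    · rw [hil, hl]
      exact zero_mem _
    · exact Algebra.subset_adjoin ⟨i, ⟨hi, hil⟩, rfl⟩
  · intro B _ _ y hy
    obtain ⟨f, hf⟩ := hS.exists_lift B (fun i => if i = l then 0 else y i) fun i hi j hj => by
      by_cases hil : i = l
      · simp [hil, (hq j).1]
      by_cases hjl : j = l
      · simp [hjl, (hq i).2]
      simpa [hil, hjl] using hy i ⟨hi, hil⟩ j ⟨hj, hjl⟩
    exact ⟨f, fun i hi => (hf i hi.1).trans (if_neg hi.2)⟩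

/-- If `a m * a j` is a scalar and `q j p ≠ 0` for some `p`, then `a m` is a multiple of `a j`. -/
theorem exists_smul_of_mul_eq (h2 : (2 : k) ≠ 0)
    (ha : ∀ i j, a i * a j + μ i j • (a j * a i) = algebraMap k A (2 * q i j)) (hμ : IsMulAntisymm μ)
    {j p m : ι} (hp : q j p ≠ 0) (hj : a j ≠ 0) {d : k} (hd : a m * a j = algebraMap k A d) :
    ∃ c : k, a m = c • a j := by
  have hsq : a j * a j = algebraMap k A (q j j) := by
    have := ha j j
    rw [(hμ j j).2, one_smul, ← two_smul k, map_mul, ← Algebra.smul_def] at this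
    exact smul_right_injective A h2 this
  -- If `a j` squares to zero, then `d = 0`, and multiplying the relation between `a j` and `a p` by
  -- `a m` recovers `a m`. Otherwise `a j` is invertible and can be cancelled.
  by_cases h : q j j = 0
  · have hd0 : d = 0 := by
      have : a m * a j * a j = 0 := by rw [mul_assoc, hsq, h, map_zero, mul_zero]
      rw [hd, ← Algebra.smul_def] at this
      exact (smul_eq_zero.1 this).resolve_right hj
    have h0 : a m * a j = 0 := by rw [hd, hd0, map_zero]
    have h1 : (2 * q j p) • a m = (μ j p * (2 * q m p)) • a j := by
      have e1 := ha j p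
      have e2 := ha m p
      calc (2 * q j p) • a m = a m * algebraMap k A (2 * q j p) := by
            rw [Algebra.smul_def, Algebra.commutes]
        _ = (a m * a j) * a p + μ j p • (a m * a p * a j) := by
            rw [← e1, mul_add, mul_smul_comm, mul_assoc, mul_assoc]
        _ = μ j p • ((algebraMap k A (2 * q m p) - μ m p • (a p * a m)) * a j) := by
            rw [h0, zero_mul, zero_add, ← e2, add_sub_cancel_right]
        _ = (μ j p * (2 * q m p)) • a j := by
            rw [sub_mul, smul_mul_assoc, mul_assoc, h0, mul_zero, smul_zero, sub_zero,
              ← Algebra.smul_def, smul_smul]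
    refine ⟨(2 * q j p)⁻¹ * (μ j p * (2 * q m p)), ?_⟩
    rw [← smul_smul, ← h1, inv_smul_smul₀ (mul_ne_zero h2 hp)]
  · refine ⟨(q j j)⁻¹ * d, ?_⟩
    have : q j j • a m = d • a j := by
      rw [Algebra.smul_def, Algebra.smul_def, Algebra.commutes, ← hsq, ← mul_assoc, hd]
    rw [← smul_smul, ← this, inv_smul_smul₀ h]

/-- A lift is extended to a discarded `l` by `c l • y j`. The relation of `l` with a kept `m`
follows from that of `j` with `m` when the factors `μ l m` and `μ j m` agree. When they differ and
`c l ≠ 0`, comparing the two relations in `A` makes `a m * a j` a scalar, so `a m` is itself a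
multiple of `a j`. Discarding all multiples at once leaves only `m = j`, where the relation concerns
just the square of `y j`. -/
theorem IsPresentedBy.remove_multiples [Nontrivial A] {S : Set ι} (hS : IsPresentedBy μ q a S)
    (h2 : (2 : k) ≠ 0)
    (ha : ∀ i j, a i * a j + μ i j • (a j * a i) = algebraMap k A (2 * q i j))
    (hμ : IsMulAntisymm μ) {j p : ι} (hjS : j ∈ S) (hp : q j p ≠ 0) :
    IsPresentedBy μ q a {l ∈ S | l = j ∨ ¬∃ c : k, a l = c • a j} := by
  classical
  have hinj := FaithfulSMul.algebraMap_injective k A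
  have hj : a j ≠ 0 := by
    intro h
    have := ha j p
    rw [h] at this
    simp only [zero_mul, mul_zero, smul_zero, add_zero] at this
    exact mul_ne_zero h2 hp (hinj (by rw [← this, map_zero]))
  have hsq : ∀ (B : Type v) [Ring B] [Algebra k B] (y : ι → B),
      y j * y j + μ j j • (y j * y j) = algebraMap k B (2 * q j j) →
        y j * y j = algebraMap k B (q j j) := fun B _ _ y h => by
    rw [(hμ j j).2, one_smul, ← two_smul k, map_mul, ← Algebra.smul_def] at h
    exact smul_right_injective B h2 h
  set T := {l ∈ S | l = j ∨ ¬∃ c : k, a l = c • a j} with hT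
  have hjT : j ∈ T := ⟨hjS, Or.inl rfl⟩
  have hc : ∀ l, ∃ c : k, l ∈ S → l ∉ T → a l = c • a j := fun l => by
    by_cases h : l ∈ S ∧ l ∉ T
    · have : ∃ c : k, a l = c • a j := by
        by_contra h'
        exact h.2 ⟨h.1, Or.inr h'⟩
      obtain ⟨c, hc⟩ := this
      exact ⟨c, fun _ _ => hc⟩
    · exact ⟨0, fun h1 h2 => absurd ⟨h1, h2⟩ h⟩
  choose c hc using hc
  constructor
  · rw [eq_top_iff, ← hS.adjoin_eq_top, Algebra.adjoin_le_iff]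
    rintro _ ⟨i, hi, rfl⟩
    by_cases hiT : i ∈ T
    · exact Algebra.subset_adjoin ⟨i, hiT, rfl⟩
    · rw [hc i hi hiT]
      exact Subalgebra.smul_mem _ (Algebra.subset_adjoin (Set.mem_image_of_mem a hjT)) _
  intro B _ _ y hy
  -- The skew commutator of a multiple of `a j` and some `a m` is the same in `A` and in `B`.
  have key : ∀ l ∈ S, l ∉ T → ∀ m ∈ T,
      c l • y j * y m + μ l m • (y m * c l • y j) = algebraMap k B (2 * q l m) := by
    intro l hl hlT m hm
    have hlA := ha l m
    rw [hc l hl hlT] at hlA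
    by_cases hcl : c l = 0
    · rw [hcl] at hlA ⊢
      simp only [zero_smul, zero_mul, mul_zero, smul_zero, add_zero] at hlA ⊢
      rw [← map_zero (algebraMap k A)] at hlA
      rw [← hinj hlA, map_zero]
    by_cases hμe : μ l m = μ j m
    · have e1 := ha j m
      have e2 := hy j hjT m hm
      rw [smul_mul_assoc, mul_smul_comm, smul_comm (μ l m), ← smul_add, hμe] at hlA ⊢
      rw [e1, Algebra.smul_def, ← map_mul] at hlA
      rw [e2, Algebra.smul_def, ← map_mul, hinj hlA]
    · rcases hm.2 with rfl | hm'
      · have e1 := hsq A a (ha m m)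
        have e2 := hsq B y (hy m hm m hm)
        rw [smul_mul_assoc, mul_smul_comm, e1, Algebra.smul_def, Algebra.smul_def, ← map_mul,
          ← map_mul, ← map_add] at hlA
        rw [smul_mul_assoc, mul_smul_comm, e2, Algebra.smul_def, Algebra.smul_def, ← map_mul,
          ← map_mul, ← map_add, hinj hlA]
      · exfalso
        have e1 := ha j m
        rw [smul_mul_assoc, mul_smul_comm, smul_comm (μ l m), ← smul_add] at hlA
        have e3 : a j * a m + μ l m • (a m * a j) = algebraMap k A ((c l)⁻¹ * (2 * q l m)) := by
          rw [map_mul, ← hlA, ← Algebra.smul_def, inv_smul_smul₀ hcl]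
        have e4 : (μ l m - μ j m) • (a m * a j) =
            algebraMap k A ((c l)⁻¹ * (2 * q l m) - 2 * q j m) := by
          rw [map_sub, ← e1, ← e3, sub_smul]
          abel
        have e5 : a m * a j = algebraMap k A
            ((μ l m - μ j m)⁻¹ * ((c l)⁻¹ * (2 * q l m) - 2 * q j m)) := by
          rw [map_mul, ← e4, ← Algebra.smul_def, inv_smul_smul₀ (sub_ne_zero.2 hμe)]
        exact hm' (exists_smul_of_mul_eq h2 ha hμ hp hj e5)
  -- The relations for `(l, i)` and `(i, l)` are equivalent; the needed symmetry of `2 * q` is read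
  -- off in `A`.
  have hswap : ∀ i l, ∀ u w : B, w * u + μ l i • (u * w) = algebraMap k B (2 * q l i) →
      u * w + μ i l • (w * u) = algebraMap k B (2 * q i l) := by
    intro i l u w h
    have e1 : μ i l • (a l * a i + μ l i • (a i * a l)) = algebraMap k A (2 * q i l) := by
      rw [smul_add, smul_smul, (hμ i l).1, one_smul, add_comm, ha]
    rw [ha, Algebra.smul_def, ← map_mul] at e1
    rw [← hinj e1, map_mul, ← h, ← Algebra.smul_def, smul_add, smul_smul, (hμ i l).1, one_smul,
      add_comm]
  have hrel : ∀ i ∈ S, ∀ l ∈ S, (if i ∈ T then y i else c i • y j) *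
      (if l ∈ T then y l else c l • y j) + μ i l • ((if l ∈ T then y l else c l • y j) *
        (if i ∈ T then y i else c i • y j)) = algebraMap k B (2 * q i l) := by
    intro i hi l hl
    by_cases hiT : i ∈ T
    · by_cases hlT : l ∈ T
      · simpa [hiT, hlT] using hy i hiT l hlT
      · simpa only [hiT, hlT, if_true, if_false] using hswap i l _ _ (key l hl hlT i hiT)
    · by_cases hlT : l ∈ T
      · simpa only [hiT, hlT, if_true, if_false] using key i hi hiT l hlT
      · have e1 := hsq A a (ha j j)
        have e2 := hsq B y (hy j hjT j hjT)
        have e3 := ha i l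
        rw [hc i hi hiT, hc l hl hlT, smul_mul_smul_comm, smul_mul_smul_comm, e1, smul_smul,
          Algebra.smul_def, Algebra.smul_def, ← map_mul, ← map_mul, ← map_add] at e3
        simp only [hiT, hlT, if_false]
        rw [smul_mul_smul_comm, smul_mul_smul_comm, e2, smul_smul, Algebra.smul_def,
          Algebra.smul_def, ← map_mul, ← map_mul, ← map_add, hinj e3]
  obtain ⟨f, hf⟩ := hS.exists_lift B (fun i => if i ∈ T then y i else c i • y j) hrel
  exact ⟨f, fun i hi => (hf i hi.1).trans (if_pos hi)⟩

/-- The two ways to reorder `a i * a j * a l` differ by a linear relation. -/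
theorem overlap (ha : ∀ i j, a i * a j + μ i j • (a j * a i) = algebraMap k A (2 * q i j))
    (i j l : ι) :
    (2 * (q j l * (1 - μ i j * μ i l))) • a i + (2 * (q i l * (μ i j - μ j l))) • a j +
      (2 * (q i j * (μ j l * μ i l - 1))) • a l = 0 := by
  have h : ∀ i j, a i * a j = (2 * q i j) • (1 : A) - μ i j • (a j * a i) := fun i j => by
    rw [← Algebra.algebraMap_eq_smul_one, ← ha, add_sub_cancel_right]
  -- Both bracketings are reduced to the reversed word `a l * a j * a i`, whose coefficient is the
  -- same in each and cancels.
  have e1 : a i * (a j * a l) = (2 * q j l) • a i - (μ j l * (2 * q i l)) • a j +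
      (μ j l * μ i l * (2 * q i j)) • a l - (μ j l * μ i l * μ i j) • (a l * (a j * a i)) := by
    rw [h j l, mul_sub, mul_smul_comm, mul_smul_comm, mul_one, ← mul_assoc, h i l, sub_mul,
      smul_mul_assoc, smul_mul_assoc, one_mul, mul_assoc, h i j, mul_sub, mul_smul_comm,
      mul_smul_comm, mul_one]
    module
  have e2 : a i * a j * a l = (2 * q i j) • a l - (μ i j * (2 * q i l)) • a j +
      (μ i j * μ i l * (2 * q j l)) • a i - (μ j l * μ i l * μ i j) • (a l * (a j * a i)) := by
    rw [h i j, sub_mul, smul_mul_assoc, smul_mul_assoc, one_mul, mul_assoc, h i l, mul_sub,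
      mul_smul_comm, mul_smul_comm, mul_one, ← mul_assoc, h j l, sub_mul, smul_mul_assoc,
      smul_mul_assoc, one_mul, mul_assoc]
    module
  have e3 := (mul_assoc (a i) (a j) (a l)).symm
  rw [e1, e2, ← sub_eq_zero] at e3
  rw [← e3]
  module

/-- In `overlap` the coefficient of `a i` is a nonzero multiple of `1 - μ i j * μ i l`. If `q i j`
or `q i l` vanishes, at most two generators remain, and minimality kills this coefficient. If
neither vanishes, both factors are already `1`. -/
theorem IsPresentedBy.mul_eq_one_of_minimal [Nontrivial A] {S : Set ι}
    (hS : Minimal (IsPresentedBy μ q a) S) (h2 : (2 : k) ≠ 0)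
    (ha : ∀ i j, a i * a j + μ i j • (a j * a i) = algebraMap k A (2 * q i j))
    (hμ : IsMulAntisymm μ) (hq : ∀ i j, q i j = μ i j * q j i)
    {i j l : ι} (hi : i ∈ S) (hj : j ∈ S) (hl : l ∈ S) (hjl : q j l ≠ 0) :
    μ i j * μ i l = 1 := by
  have hzero : ∀ i ∈ S, a i ≠ 0 := fun i hi h0 =>
    (hS.2 (hS.1.diff_singleton ha h0) Set.sdiff_subset hi).2 rfl
  -- Were `r` nonzero, `a i` would be a multiple of `a j`, and `IsPresentedBy.remove_multiples`
  -- would give a smaller presenting set.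
  have hmult : ∀ i ∈ S, ∀ j ∈ S, ∀ p, i ≠ j → q j p ≠ 0 → ∀ r s : k, r • a i + s • a j = 0 →
      r = 0 := by
    intro i hi j hj p hij hp r s h
    by_contra hr
    have hmem := hS.2 (hS.1.remove_multiples h2 ha hμ hj hp) (Set.sep_subset _ _) hi
    refine hmem.2.elim hij fun h' => h' ⟨r⁻¹ * -s, ?_⟩
    rw [← smul_smul, neg_smul, ← eq_neg_of_add_eq_zero_left h, inv_smul_smul₀ hr]
  have hsymm : ∀ i j, q i j ≠ 0 → q j i ≠ 0 := fun i j h h' => h (by rw [hq, h', mul_zero])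
  have h22 : (2 : k) * 2 ≠ 0 := mul_ne_zero h2 h2
  have hpair : ∀ i ∈ S, ∀ j ∈ S, q i j ≠ 0 → μ i j = 1 := by
    intro i hi j hj hij
    rcases eq_or_ne i j with rfl | hne
    · exact (hμ i i).2
    -- With a repeated index the overlap involves only `a i` and `a j`, and the coefficient of `a i`
    -- is `4 * q i j * (1 - μ i j)`.
    have e := overlap ha i i j
    rw [(hμ i i).2, one_mul, ← add_smul] at e
    have := hmult i hi j hj i hne (hsymm i j hij) _ _ e
    have h3 : (2 * 2) * q i j * (1 - μ i j) = 0 := by rw [← this]; ring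
    exact (sub_eq_zero.1 ((mul_eq_zero.1 h3).resolve_left (mul_ne_zero h22 hij))).symm
  have hone : ∀ i ∈ S, ∀ c : k, c • a i = 0 → c = 0 := fun i hi c h =>
    (smul_eq_zero.1 h).resolve_right (hzero i hi)
  have hfin : 2 * (q j l * (1 - μ i j * μ i l)) = 0 → μ i j * μ i l = 1 := fun h =>
    (sub_eq_zero.1 (((mul_eq_zero.1 ((mul_eq_zero.1 h).resolve_left h2))).resolve_left hjl)).symm
  by_cases hij0 : q i j = 0
  · by_cases hil0 : q i l = 0
    · have e := overlap ha i j l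
      rw [hij0, hil0] at e
      simp only [zero_mul, mul_zero, zero_smul, add_zero] at e
      exact hfin (hone i hi _ e)
    · rcases eq_or_ne i j with rfl | hne
      · rw [(hμ i i).2, hpair i hi l hl hil0, one_mul]
      have e := overlap ha i j l
      rw [hij0] at e
      simp only [zero_mul, mul_zero, zero_smul, add_zero] at e
      exact hfin (hmult i hi j hj l hne hjl _ _ e)
  · by_cases hil0 : q i l = 0
    · rcases eq_or_ne i l with rfl | hne
      · rw [(hμ i i).2, hpair i hi j hj hij0, one_mul]
      have e := overlap ha i j l
      rw [hil0] at e
      simp only [zero_mul, mul_zero, zero_smul, add_zero] at e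
      exact hfin (hmult i hi l hl j hne (hsymm j l hjl) _ _ e)
    · rw [hpair i hi j hj hij0, hpair i hi l hl hil0, one_mul]

end Presentation

/-! ### Passage to the span of a subset of the basis -/

section Restriction

variable {k V ι : Type*} [Field k] [AddCommGroup V] [Module k V]
  {x : Module.Basis ι k V} {μ : Matrix ι ι k} {φ : LinearMap.BilinForm k V}

theorem subbasis_apply (x : Module.Basis ι k V) (s : Set ι) (i : s) :
    (subbasis x s i : V) = x i :=
  congrArg Subtype.val (Module.Basis.span_apply _ i)

theorem isPresentedBy_univ :
    IsPresentedBy μ (fun i j => φ (x i) (x j)) (fun i => g x μ φ (x i)) Set.univ where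
  adjoin_eq_top := by rw [Set.image_univ, adjoin_range_g]
  exists_lift B _ _ y hy := by
    obtain ⟨f, hf⟩ := exists_lift x μ φ y fun i j => hy i trivial j trivial
    exact ⟨f, fun i _ => hf i⟩

/-- Both algebras have the same generators and defining relations. Compatibility with the maps `g`
is recorded so that injectivity on the subspace can be transported back. -/
theorem IsPresentedBy.exists_algEquiv {s : Set ι}
    (hs : IsPresentedBy μ (fun i j => φ (x i) (x j)) (fun i => g x μ φ (x i)) s) :
    ∃ e : SkewCliffordAlgebra x μ φ ≃ₐ[k]
      SkewCliffordAlgebra (subbasis x s) (submatrix μ s) (φ.restrict (subspace x s)),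
      ∀ v : subspace x s, e (g x μ φ v) =
        g (subbasis x s) (submatrix μ s) (φ.restrict (subspace x s)) v := by
  classical
  set g' := g (subbasis x s) (submatrix μ s) (φ.restrict (subspace x s)) with hg'
  have hφ' : ∀ i j : s, φ.restrict (subspace x s) (subbasis x s i) (subbasis x s j) =
      φ (x i) (x j) := fun i j => by
    rw [← subbasis_apply x s i, ← subbasis_apply x s j]; rfl
  obtain ⟨f, hf⟩ := hs.exists_lift
    (SkewCliffordAlgebra (subbasis x s) (submatrix μ s) (φ.restrict (subspace x s)))
    (fun i => if h : i ∈ s then g' (subbasis x s ⟨i, h⟩) else 0) fun i hi j hj => by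
      have := g_mul_g (subbasis x s) (submatrix μ s) (φ.restrict (subspace x s)) ⟨i, hi⟩ ⟨j, hj⟩
      rw [hφ'] at this
      simp only [hi, hj, dif_pos]
      exact this
  obtain ⟨h, hh⟩ := SkewCliffordAlgebra.exists_lift (subbasis x s) (submatrix μ s)
    (φ.restrict (subspace x s)) (fun i => g x μ φ (x i)) fun i j => by
      rw [hφ']; exact g_mul_g x μ φ i j
  have hf' : ∀ i : s, f (g x μ φ (x i)) = g' (subbasis x s i) := fun i =>
    (hf i i.2).trans (dif_pos i.2)
  have h1 : f.comp h = AlgHom.id k _ := by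
    refine AlgHom.ext_of_adjoin_eq_top (adjoin_range_g _ _ _) ?_
    rintro _ ⟨i, rfl⟩
    simp [hh, hf', hg']
  have h2 : h.comp f = AlgHom.id k _ := by
    refine AlgHom.ext_of_adjoin_eq_top hs.adjoin_eq_top ?_
    rintro _ ⟨i, hi, rfl⟩
    have := hf' ⟨i, hi⟩
    simp only at this
    simp [this, hh, hg']
  refine ⟨AlgEquiv.ofAlgHom f h h1 h2, fun v => ?_⟩
  have : f.toLinearMap ∘ₗ (g x μ φ).domRestrict (subspace x s) = g' := by
    refine (subbasis x s).ext fun i => ?_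
    simpa [subbasis_apply] using hf' i
  exact LinearMap.congr_fun this v

end Restriction

end SkewCliffordAlgebra

/-! ### The main theorem -/

theorem theorem3 {k V : Type*} [Field k] (hchar : ringChar k ≠ 2) [AddCommGroup V] [Module k V]
    {n : ℕ} (x : Module.Basis (Fin n) k V) (μ : Matrix (Fin n) (Fin n) k)
    (hμ : IsMulAntisymm μ) (φ : LinearMap.BilinForm k V) (hφ : IsMuSymm x μ φ)
    (hnt : Nontrivial (SkewCliffordAlgebra x μ φ)) :
    ∃ s : Set (Fin n),
      IsMulAntisymm (SkewCliffordAlgebra.submatrix μ s) ∧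
      IsMuSymm (SkewCliffordAlgebra.subbasis x s) (SkewCliffordAlgebra.submatrix μ s)
        (φ.restrict (SkewCliffordAlgebra.subspace x s)) ∧
      Nonempty (SkewCliffordAlgebra x μ φ ≃ₐ[k]
        SkewCliffordAlgebra (SkewCliffordAlgebra.subbasis x s)
          (SkewCliffordAlgebra.submatrix μ s)
          (φ.restrict (SkewCliffordAlgebra.subspace x s))) ∧
      Function.Injective
        ((SkewCliffordAlgebra.g x μ φ).domRestrict (SkewCliffordAlgebra.subspace x s)) ∧
      SkewCliffordAlgebra.HasFullDimension (SkewCliffordAlgebra.subbasis x s)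
        (SkewCliffordAlgebra.submatrix μ s)
        (φ.restrict (SkewCliffordAlgebra.subspace x s)) := by
  classical
  have h2 : (2 : k) ≠ 0 := Ring.two_ne_zero hchar
  -- The full index set presents the algebra, and the subsets of `Fin n` are finite in number, so a
  -- minimal presenting subset exists.
  obtain ⟨s, -, hs⟩ := exists_minimal_le_of_wellFoundedLT
    (SkewCliffordAlgebra.IsPresentedBy μ (fun i j => φ (x i) (x j))
      (fun i => SkewCliffordAlgebra.g x μ φ (x i))) Set.univ
    SkewCliffordAlgebra.isPresentedBy_univ
  have hφ' : ∀ i j : s, φ.restrict (SkewCliffordAlgebra.subspace x s)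
      (SkewCliffordAlgebra.subbasis x s i) (SkewCliffordAlgebra.subbasis x s j) =
      φ (x i) (x j) := fun i j => by
    rw [← SkewCliffordAlgebra.subbasis_apply x s i, ← SkewCliffordAlgebra.subbasis_apply x s j]
    rfl
  have hμs : IsMulAntisymm (SkewCliffordAlgebra.submatrix μ s) := fun i j => hμ i j
  have hφs : IsMuSymm (SkewCliffordAlgebra.subbasis x s) (SkewCliffordAlgebra.submatrix μ s)
      (φ.restrict (SkewCliffordAlgebra.subspace x s)) := fun i j => by
    rw [hφ', hφ']
    exact hφ i j
  have hC : ∀ i j l : s, φ.restrict (SkewCliffordAlgebra.subspace x s)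
      (SkewCliffordAlgebra.subbasis x s j) (SkewCliffordAlgebra.subbasis x s l) ≠ 0 →
      SkewCliffordAlgebra.submatrix μ s i j * SkewCliffordAlgebra.submatrix μ s i l = 1 :=
    fun i j l h => SkewCliffordAlgebra.IsPresentedBy.mul_eq_one_of_minimal hs h2
      (SkewCliffordAlgebra.g_mul_g x μ φ) hμ hφ i.2 j.2 l.2 (by rwa [hφ'] at h)
  obtain ⟨e, he⟩ := hs.1.exists_algEquiv
  refine ⟨s, hμs, hφs, ⟨e⟩, fun v w hvw => ?_,
    SkewCliffordAlgebra.hasFullDimension h2 hμs hφs hC⟩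
  apply SkewCliffordAlgebra.g_injective hμs hφs hC
  rw [← he, ← he]
  exact congrArg e hvw
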